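/- For a finite connected graph $G=(V,E)$ let $(J_e)_{e\in E}$ be i.i.d. standard Gaussian couplings, and let $\sigma\in\{-1,+1\}^V$ be a ground state, i.e. a maximizer of $H(\sigma)=\sum_{e=\{x,y\}\in E}J_e\sigma_x\sigma_y$; almost surely $\sigma$ is unique up to a global sign, so for $u,v\in V$ the product $\sigma_u\sigma_v$ is almost surely a well-defined function of $J$. Let $h_k$ ($k\ge 0$) be the Hermite polynomials, normalized to be orthonormal with respect to the standard Gaussian measure on $\mathbb{R}$. For $\mathbf{k}\in\{0,1,2,\dots\}^E$ put $\alpha_{\mathbf{k}}=\mathbb{E}\big[\sigma_u\sigma_v\prod_{e\in E}h_{k_e}(J_e)\big]$, and for $S\subseteq E$ define the spectral mass $\mu(S)=\sum_{\mathbf{k}:\,\{e\in E:\,k_e\ge 1\}=S}\alpha_{\mathbf{k}}^2$. There exists a constant $c>0$ such that the following holds for every even integer $n\ge 2$. Let $G$ be the grid $\{(i,j)\in\mathbb{Z}^2: 1\le i,j\le n\}$ with nearest neighbor edges, let $u=(1,n/2)$ and $v=(n,n/2)$, and let $\mu$ be the spectral mass for $\sigma_u\sigma_v$. Let $\mathcal{L}$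 be the set of edges $\{(k,n/2),(k+1,n/2)\}$, $1\le k<n$, and let $\widehat{\mathcal{L}}$ be the set consisting of $\mathcal{L}$ and all edges that share a vertex with some edge of $\mathcal{L}$. Then $$\sum_{\mathcal{L}\subseteq S\subseteq\widehat{\mathcal{L}}}\mu(S)\;\ge\; e^{-cn\log n},$$ and there is a set $S$ with $\mathcal{L}\subseteq S\subseteq\widehat{\mathcal{L}}$ and $\mu(S)\ge e^{-cn\log n}$. -/

import Mathlib

open MeasureTheory ProbabilityTheory
open scoped Nat

noncomputable section

namespace EdwardsAnderson

section GeneralGraph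

variable {V : Type*} (G : SimpleGraph V)

/-- A realization of the couplings: one real number `J e` for each edge `e` of `G`. -/
abbrev Coupling : Type _ := G.edgeSet → ℝ

/-- Spin configurations `σ ∈ {-1, +1}^V`. -/
abbrev SpinConfig (V : Type*) : Type _ := V → ℤˣ

/-- The product `σ_x σ_y` of the spins at the two ends of `e = {x, y}`. -/
def edgeSpin (σ : SpinConfig V) (e : Sym2 V) : ℝ :=
  Sym2.lift ⟨fun x y => (((σ x * σ y : ℤˣ) : ℤ) : ℝ), fun x y => by simp only [mul_comm]⟩ e

/-- The Hamiltonian `H(σ) = ∑_{e = {x, y}} J_e σ_x σ_y`. -/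
def hamiltonian [Fintype G.edgeSet] (J : Coupling G) (σ : SpinConfig V) : ℝ :=
  ∑ e : G.edgeSet, J e * edgeSpin σ e

/-- A ground state is a maximizer of the Hamiltonian. -/
def IsGroundState [Fintype G.edgeSet] (J : Coupling G) (σ : SpinConfig V) : Prop :=
  ∀ τ : SpinConfig V, hamiltonian G J τ ≤ hamiltonian G J σ

theorem exists_isGroundState [Finite V] [Fintype G.edgeSet] (J : Coupling G) :
    ∃ σ : SpinConfig V, IsGroundState G J σ :=
  Finite.exists_max (hamiltonian G J)

/-- A ground state for the couplings `J`. On a connected graph it is unique up to a global sign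
for almost every `J`, so that the choice affects the relative spins only on a null set. -/
def groundState [Finite V] [Fintype G.edgeSet] (J : Coupling G) : SpinConfig V :=
  Classical.choose (exists_isGroundState G J)

/-- The relative spin `σ_u σ_v` of the ground state, as a function of the couplings. -/
def relSpin [Finite V] [Fintype G.edgeSet] (u v : V) (J : Coupling G) : ℝ :=
  ((groundState G J u * groundState G J v : ℤˣ) : ℤ)

/-- The law of the couplings: independent standard Gaussians. -/
def couplingLaw [Fintype G.edgeSet] : Measure (Coupling G) :=
  Measure.pi fun _ => gaussianReal 0 1

/-- The Hermite polynomial of degree `k`, normalized to be orthonormal for the standard Gaussian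
(`Polynomial.hermite k` is the monic one, whose second moment is `k!`). -/
def hermiteFn (k : ℕ) (x : ℝ) : ℝ :=
  Polynomial.aeval x (Polynomial.hermite k) / √(k ! : ℝ)

/-- The basis function `h_𝐤(J) = ∏_e h_{k_e}(J_e)`. -/
def hermiteProd [Fintype G.edgeSet] (k : G.edgeSet → ℕ) (J : Coupling G) : ℝ :=
  ∏ e : G.edgeSet, hermiteFn (k e) (J e)

/-- The Fourier coefficient `α_𝐤 = 𝔼[σ_u σ_v h_𝐤(J)]`. -/
def fourierCoeff [Finite V] [Fintype G.edgeSet] (u v : V) (k : G.edgeSet → ℕ) : ℝ :=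
  ∫ J, relSpin G u v J * hermiteProd G k J ∂(couplingLaw G)

/-- The support `E_𝐤 = {e : k_e ≥ 1}`. -/
def multiSupport [Fintype G.edgeSet] (k : G.edgeSet → ℕ) : Finset G.edgeSet :=
  Finset.univ.filter fun e => 1 ≤ k e

/-- The spectral mass `μ(S) = ∑_{𝐤 : E_𝐤 = S} α_𝐤²` of a set `S` of edges. -/
def spectralMass [Finite V] [Fintype G.edgeSet] (u v : V) (S : Finset G.edgeSet) : ℝ :=
  ∑' k : {k : G.edgeSet → ℕ // multiSupport G k = S}, fourierCoeff G u v k.1 ^ 2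

end GeneralGraph

section Grid

/-- The vertices `(i, j) ∈ ℤ²` with `1 ≤ i, j ≤ n`. -/
abbrev GridVertex (n : ℕ) : Type :=
  ↥(Finset.Icc (1 : ℤ) n ×ˢ Finset.Icc (1 : ℤ) n)

/-- The `n × n` grid with nearest neighbour edges (Manhattan distance one). -/
def grid (n : ℕ) : SimpleGraph (GridVertex n) where
  Adj x y := |x.1.1 - y.1.1| + |x.1.2 - y.1.2| = 1
  symm := ⟨fun x y h => by rw [abs_sub_comm y.1.1, abs_sub_comm y.1.2]; exact h⟩
  loopless := ⟨fun x h => by simp at h⟩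

instance (n : ℕ) : Fintype (grid n).edgeSet := Fintype.ofFinite _

/-- `u = (1, n/2)`. -/
def leftEnd (n : ℕ) (hn : 2 ≤ n) : GridVertex n :=
  ⟨(1, (n : ℤ) / 2), by simp only [Finset.mem_product, Finset.mem_Icc]; omega⟩

/-- `v = (n, n/2)`. -/
def rightEnd (n : ℕ) (hn : 2 ≤ n) : GridVertex n :=
  ⟨((n : ℤ), (n : ℤ) / 2), by simp only [Finset.mem_product, Finset.mem_Icc]; omega⟩

open Classical in
/-- The horizontal line `ℒ`: the edges `{(k, n/2), (k+1, n/2)}` with `1 ≤ k < n`. -/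
def line (n : ℕ) : Finset (grid n).edgeSet :=
  Finset.univ.filter fun e => ∃ k : ℤ, 1 ≤ k ∧ k < n ∧
    Sym2.map Subtype.val e.1 = s((k, (n : ℤ) / 2), (k + 1, (n : ℤ) / 2))

open Classical in
/-- `ℒ̂`: the edges of `ℒ` and all edges which share a vertex with an edge of `ℒ`. -/
def lineHat (n : ℕ) : Finset (grid n).edgeSet :=
  line n ∪ Finset.univ.filter fun e => ∃ f ∈ line n, ∃ w : GridVertex n, w ∈ e.1 ∧ w ∈ f.1

end Grid

end EdwardsAnderson

end

/-! Test $\sigma_u\sigma_v$ against a product function $f(J)=\prod_e f_e(J_e)$. For $e\in\mathcal L$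
the factor is $\operatorname{sgn}(J_e)$ cut off to $|J_e|>1$, for $e\in\widehat{\mathcal
L}\setminus\mathcal L$ it is the indicator of $|J_e|\le 1/(4n)$, and elsewhere it is $1$. Where
$f\neq0$, every line edge is satisfied in the ground state: flipping the part of the row to the left
of the edge changes, besides that edge, only weak edges of total strength at most $1$. Multiplying
the edge spins along the line gives $\sigma_u\sigma_v=\prod_{e\in\mathcal L}\operatorname{sgn}J_e$,
so $\sigma_u\sigma_v f=f^2$ (`relSpin_mul_prod_testFn`).

Since $f$ depends only on $\widehat{\mathcal L}$ and each line factor has mean zero, its Hermite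
coefficients vanish unless $\mathcal L\subseteq E_{\mathbf k}\subseteq\widehat{\mathcal L}$.
Cauchy–Schwarz on these coefficients (`sq_integral_relSpin_mul_prod_le`) gives $(\mathbb E
f^2)^2\le\mathbb E f^2\cdot\sum\mu(S)$, hence $\sum\mu(S)\ge\mathbb E f^2=\prod_e\mathbb E
f_e^2\ge(\delta/n)^{4n}$. There are at most $2^{4n}$ admissible $S$, so one of them carries the
average, and the factor $2^{4n}$ is absorbed into $c$. -/

noncomputable section

namespace EdwardsAnderson

/-! ### Hermite polynomials on the line: orthonormality, completeness, Parseval. -/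

section OneDimensionalHermite

open Polynomial Filter

/-- The standard Gaussian measure on the line. -/
abbrev stdGaussian : Measure ℝ := gaussianReal 0 1

/-- The monic Hermite polynomial with real coefficients. -/
def realHermite (n : ℕ) : ℝ[X] := (hermite n).map (Int.castRingHom ℝ)

theorem realHermite_succ (n : ℕ) :
    realHermite (n + 1) = X * realHermite n - derivative (realHermite n) := by
  simp [realHermite, hermite_succ, Polynomial.derivative_map]

theorem realHermite_monic (n : ℕ) : (realHermite n).Monic := (hermite_monic n).map _

theorem natDegree_realHermite (n : ℕ) : (realHermite n).natDegree = n := by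
  rw [realHermite, (hermite_monic n).natDegree_map, natDegree_hermite]

theorem hermiteFn_eq (k : ℕ) (x : ℝ) :
    hermiteFn k x = (realHermite k).eval x / √(k ! : ℝ) := by
  rw [hermiteFn, realHermite, aeval_def, eval₂_eq_eval_map]
  rfl

theorem integrable_pow_stdGaussian (n : ℕ) : Integrable (fun x : ℝ => x ^ n) stdGaussian :=
  integrable_pow_of_mem_interior_integrableExpSet (X := id)
    (by rw [integrableExpSet_id_gaussianReal]; simp) n

theorem integrable_eval_stdGaussian (p : ℝ[X]) :
    Integrable (fun x : ℝ => p.eval x) stdGaussian := by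
  simp_rw [eval_eq_sum_range]
  exact integrable_finsetSum _ fun i _ => (integrable_pow_stdGaussian i).const_mul _

theorem memLp_eval_stdGaussian (p : ℝ[X]) : MemLp (fun x : ℝ => p.eval x) 2 stdGaussian := by
  rw [memLp_two_iff_integrable_sq p.continuous.aestronglyMeasurable]
  exact (integrable_eval_stdGaussian (p ^ 2)).congr (ae_of_all _ fun x => eval_pow 2)

theorem memLp_hermiteFn (k : ℕ) : MemLp (hermiteFn k) 2 stdGaussian := by
  have h : hermiteFn k = fun x => (C (√(k ! : ℝ))⁻¹ * realHermite k).eval x := by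
    ext x
    simp [hermiteFn_eq, div_eq_inv_mul]
  rw [h]
  exact memLp_eval_stdGaussian _

theorem hasDerivAt_gaussianPDFReal (x : ℝ) :
    HasDerivAt (gaussianPDFReal 0 1) (-(x * gaussianPDFReal 0 1 x)) x := by
  have h : HasDerivAt (fun y : ℝ => (√(2 * Real.pi))⁻¹ * Real.exp (-y ^ 2 / 2))
      ((√(2 * Real.pi))⁻¹ * (Real.exp (-x ^ 2 / 2) * (-(2 * x) / 2))) x := by
    refine HasDerivAt.const_mul _ (HasDerivAt.exp ?_)
    have := ((hasDerivAt_pow 2 x).neg).div_const 2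
    simpa using this
  have e : gaussianPDFReal 0 1 = fun y : ℝ => (√(2 * Real.pi))⁻¹ * Real.exp (-y ^ 2 / 2) := by
    ext y
    simp [gaussianPDFReal]
  rw [e]
  convert h using 1
  ring

theorem integrable_eval_mul_pdf (p : ℝ[X]) :
    Integrable (fun x : ℝ => p.eval x * gaussianPDFReal 0 1 x) := by
  have h := integrable_eval_stdGaussian p
  rw [stdGaussian, gaussianReal_of_var_ne_zero _ one_ne_zero,
    integrable_withDensity_iff_integrable_smul' (measurable_gaussianPDF 0 1)
      (ae_of_all _ fun _ => gaussianPDF_lt_top)] at h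
  simpa [toReal_gaussianPDF, mul_comm] using h

/-- Gaussian integration by parts for polynomials. -/
theorem integral_mul_eval_stdGaussian (p : ℝ[X]) :
    ∫ x, (X * p).eval x ∂stdGaussian = ∫ x, (derivative p).eval x ∂stdGaussian := by
  rw [integral_gaussianReal_eq_integral_smul one_ne_zero,
    integral_gaussianReal_eq_integral_smul one_ne_zero]
  have h := integral_mul_deriv_eq_deriv_mul_of_integrable
    (u := fun x => p.eval x) (u' := fun x => (derivative p).eval x)
    (v := gaussianPDFReal 0 1) (v' := fun x => -(x * gaussianPDFReal 0 1 x))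
    (fun x _ => p.hasDerivAt x) (fun x _ => hasDerivAt_gaussianPDFReal x)
    (by
      refine (integrable_eval_mul_pdf (X * p)).neg.congr (ae_of_all _ fun x => ?_)
      simp only [Pi.neg_apply, Pi.mul_apply, eval_mul, eval_X]
      ring)
    (integrable_eval_mul_pdf _) (integrable_eval_mul_pdf _)
  have h1 : ∀ x : ℝ, gaussianPDFReal 0 1 x • (X * p).eval x
      = -(p.eval x * -(x * gaussianPDFReal 0 1 x)) := fun x => by
    simp only [smul_eq_mul, eval_mul, eval_X]
    ring
  simp_rw [h1, integral_neg, h, neg_neg, smul_eq_mul, mul_comm]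

/-- By the Hermite recursion, each integration by parts trades one degree of the Hermite factor for
a derivative of `q`. Orthogonality and the norm $n!$ then follow by counting degrees. -/
theorem integral_realHermite_mul (n : ℕ) (q : ℝ[X]) :
    ∫ x, (realHermite n * q).eval x ∂stdGaussian
      = ∫ x, (derivative^[n] q).eval x ∂stdGaussian := by
  induction n generalizing q with
  | zero => simp [realHermite]
  | succ n ih =>
    rw [Function.iterate_succ_apply, ← ih]
    have e : realHermite (n + 1) * q
        = X * (realHermite n * q) - derivative (realHermite n) * q := by
      rw [realHermite_succ]
      ring
    have e' : derivative (realHermite n * q) - derivative (realHermite n) * q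
        = realHermite n * derivative q := by
      rw [derivative_mul]
      ring
    simp_rw [e, ← e', eval_sub]
    rw [integral_sub (integrable_eval_stdGaussian _) (integrable_eval_stdGaussian _),
      integral_sub (integrable_eval_stdGaussian _) (integrable_eval_stdGaussian _),
      integral_mul_eval_stdGaussian]

theorem integral_realHermite_mul_of_lt {m n : ℕ} (h : m < n) :
    ∫ x, (realHermite n * realHermite m).eval x ∂stdGaussian = 0 := by
  rw [integral_realHermite_mul, iterate_derivative_eq_zero (by rwa [natDegree_realHermite])]
  simp

theorem integral_realHermite_mul_self (n : ℕ) :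
    ∫ x, (realHermite n * realHermite n).eval x ∂stdGaussian = n ! := by
  have h : derivative^[n] (realHermite n) = C (n ! : ℝ) := by
    ext m
    rw [coeff_iterate_derivative, coeff_C]
    split_ifs with hm
    · subst hm
      have := (realHermite_monic n).coeff_natDegree
      rw [natDegree_realHermite] at this
      simp [this, Nat.descFactorial_self]
    · rw [coeff_eq_zero_of_natDegree_lt (by rw [natDegree_realHermite]; omega)]
      simp
  rw [integral_realHermite_mul, h]
  simp

theorem integral_hermiteFn_mul (j k : ℕ) :
    ∫ x, hermiteFn j x * hermiteFn k x ∂stdGaussian = if j = k then 1 else 0 := by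
  have e : ∀ x, hermiteFn j x * hermiteFn k x
      = (realHermite j * realHermite k).eval x / (√(j ! : ℝ) * √(k ! : ℝ)) := fun x => by
    rw [hermiteFn_eq, hermiteFn_eq, eval_mul, div_mul_div_comm]
  simp_rw [e, integral_div]
  split_ifs with h
  · subst h
    rw [integral_realHermite_mul_self, Real.mul_self_sqrt (Nat.cast_nonneg _)]
    exact div_self (Nat.cast_ne_zero.2 (Nat.factorial_ne_zero _))
  · rcases lt_or_gt_of_ne h with h | h
    · rw [mul_comm (realHermite j), integral_realHermite_mul_of_lt h, zero_div]
    · rw [integral_realHermite_mul_of_lt h, zero_div]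

/-- A square-integrable function orthogonal to all Hermite polynomials is orthogonal to all
polynomials. -/
theorem integral_mul_eval_eq_zero {g : ℝ → ℝ} (hg : MemLp g 2 stdGaussian)
    (h : ∀ k, ∫ x, g x * hermiteFn k x ∂stdGaussian = 0) (p : ℝ[X]) :
    ∫ x, g x * p.eval x ∂stdGaussian = 0 := by
  have hint : ∀ q : ℝ[X], Integrable (fun x => g x * q.eval x) stdGaussian := fun q =>
    hg.integrable_mul (memLp_eval_stdGaussian q)
  have hH : ∀ k, ∫ x, g x * (realHermite k).eval x ∂stdGaussian = 0 := fun k => by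
    have hs : (√(k ! : ℝ)) ≠ 0 := by positivity
    have := h k
    simp_rw [hermiteFn_eq, ← mul_div_assoc, integral_div] at this
    simpa [hs, div_eq_zero_iff] using this
  induction hn : p.natDegree using Nat.strong_induction_on generalizing p with
  | _ n ih =>
    subst hn
    -- The Hermite polynomial is monic of the same degree, so the leading term cancels; in degree
    -- zero nothing is left.
    set q := p - C p.leadingCoeff * realHermite p.natDegree with hq
    have hp : ∀ x, g x * p.eval x
        = g x * q.eval x + p.leadingCoeff * (g x * (realHermite p.natDegree).eval x) := fun x => by
      simp only [hq, eval_sub, eval_mul, eval_C]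
      ring
    simp_rw [hp]
    rw [integral_add (hint q) ((hint _).const_mul _), integral_const_mul, hH, mul_zero, add_zero]
    by_cases hq0 : q = 0
    · simp [hq0]
    by_cases hd : p.natDegree = 0
    · refine absurd ?_ hq0
      rw [hq, hd, eq_C_of_natDegree_eq_zero hd]
      simp [realHermite]
    refine ih _ ?_ q rfl
    have hp0 : p ≠ 0 := fun h0 => hd (by simp [h0])
    refine natDegree_lt_natDegree hq0 (degree_sub_lt_left ?_ hp0 ?_)
    · rw [degree_C_mul (leadingCoeff_ne_zero.2 hp0), degree_eq_natDegree hp0,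
        degree_eq_natDegree (realHermite_monic _).ne_zero, natDegree_realHermite]
    · rw [leadingCoeff_mul, leadingCoeff_C, (realHermite_monic _).leadingCoeff, mul_one]

theorem memLp_exp_mul_abs (t : ℝ) : MemLp (fun x => Real.exp (t * |x|)) 2 stdGaussian := by
  rw [memLp_two_iff_integrable_sq (by fun_prop)]
  have h := integrable_exp_mul_abs (X := id) (μ := stdGaussian) (t := 2 * t)
    (integrable_exp_mul_gaussianReal _) (integrable_exp_mul_gaussianReal _)
  refine h.congr (ae_of_all _ fun x => ?_)
  simp only [id]
  rw [← Real.exp_nat_mul]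
  push_cast
  ring_nf

/-- The exponential series may be integrated termwise, dominated by $|g(x)|e^{|t||x|}$, a product of
two $L^2$ functions; each term is a polynomial moment of `g`, hence zero. -/
theorem integral_mul_cexp_eq_zero {g : ℝ → ℝ} (hg : MemLp g 2 stdGaussian)
    (h : ∀ k, ∫ x, g x * hermiteFn k x ∂stdGaussian = 0) (t : ℝ) :
    ∫ x, (g x : ℂ) * Complex.exp (t * x * Complex.I) ∂stdGaussian = 0 := by
  have key := hasSum_integral_of_dominated_convergence (μ := stdGaussian)
    (F := fun (n : ℕ) (x : ℝ) => (g x : ℂ) * ((t * x * Complex.I) ^ n / n !))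
    (f := fun x => (g x : ℂ) * Complex.exp (t * x * Complex.I))
    (fun n x => |g x| * ((|t| * |x|) ^ n / n !))
    (fun n => (Complex.continuous_ofReal.comp_aestronglyMeasurable hg.1).mul
      (by fun_prop))
    (fun n => ae_of_all _ fun x => by simp)
    (ae_of_all _ fun x => ((NormedSpace.expSeries_div_summable (|t| * |x|))).mul_left _)
    (by
      have : (fun x => ∑' n : ℕ, |g x| * ((|t| * |x|) ^ n / n !))
          = fun x => |g x| * Real.exp (|t| * |x|) := by
        ext x
        rw [tsum_mul_left, Real.exp_eq_exp_ℝ, NormedSpace.exp_eq_tsum_div]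
      rw [this]
      exact hg.abs.integrable_mul (memLp_exp_mul_abs _))
    (ae_of_all _ fun x => by
      have := (NormedSpace.expSeries_div_hasSum_exp (t * x * Complex.I : ℂ)).mul_left (g x : ℂ)
      rwa [← Complex.exp_eq_exp_ℂ] at this)
  refine key.unique ?_
  have hz : ∀ n : ℕ, ∫ x, (g x : ℂ) * ((t * x * Complex.I) ^ n / n !) ∂stdGaussian = 0 := by
    intro n
    have e : ∀ x : ℝ, (g x : ℂ) * ((t * x * Complex.I) ^ n / n !)
        = ((t * Complex.I) ^ n / n !) * ((g x * (X ^ n : ℝ[X]).eval x : ℝ) : ℂ) := fun x => by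
      simp only [eval_pow, eval_X, Complex.ofReal_mul, Complex.ofReal_pow]
      ring
    simp_rw [e]
    rw [integral_const_mul, integral_complex_ofReal, integral_mul_eval_eq_zero hg h]
    simp
  simp_rw [hz]
  exact hasSum_zero

/-- Completeness of the Hermite polynomials. -/
theorem ae_eq_zero_of_integral_hermiteFn {g : ℝ → ℝ} (hg : MemLp g 2 stdGaussian)
    (h : ∀ k, ∫ x, g x * hermiteFn k x ∂stdGaussian = 0) : g =ᵐ[stdGaussian] 0 := by
  wlog hgm : Measurable g generalizing g
  · obtain ⟨g', hg'm, hg'⟩ := hg.1.aemeasurable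
    refine hg'.trans (this ((memLp_congr_ae hg').1 hg) (fun k => ?_) hg'm)
    rw [← h k]
    refine integral_congr_ae ?_
    filter_upwards [hg'] with x hx
    rw [hx]
  have hint : Integrable g stdGaussian := hg.integrable one_le_two
  have hfin : ∀ f : ℝ → ℝ, Integrable f stdGaussian →
      ∫⁻ x, ENNReal.ofReal (f x) ∂stdGaussian ≠ ⊤ := fun f hf =>
    (lt_of_le_of_lt (lintegral_mono fun x => Real.ofReal_le_enorm _) hf.2).ne
  have hchar : ∀ (f : ℝ → ℝ), Measurable f → ∀ t : ℝ,
      charFun (stdGaussian.withDensity fun x => ENNReal.ofReal (f x)) t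
        = ∫ x, ((max (f x) 0 : ℝ) : ℂ) * Complex.exp (t * x * Complex.I) ∂stdGaussian := by
    intro f hf t
    rw [charFun_apply_real, integral_withDensity_eq_integral_toReal_smul hf.ennreal_ofReal
      (ae_of_all _ fun _ => ENNReal.ofReal_lt_top)]
    simp [ENNReal.toReal_ofReal']
  have hci : ∀ (f : ℝ → ℝ), Integrable f stdGaussian → ∀ t : ℝ,
      Integrable (fun x : ℝ => (f x : ℂ) * Complex.exp (t * x * Complex.I)) stdGaussian := by
    intro f hf t
    refine hf.ofReal.mul_bdd (c := 1) (by fun_prop) (ae_of_all _ fun x => ?_)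
    rw [show (t * x * Complex.I : ℂ) = ((t * x : ℝ) : ℂ) * Complex.I by push_cast; ring,
      Complex.norm_exp_ofReal_mul_I]
  have := isFiniteMeasure_withDensity (hfin g hint)
  have := isFiniteMeasure_withDensity (hfin (fun x => -g x) hint.neg)
  -- The positive and negative parts of `g` are densities of finite measures whose characteristic
  -- functions differ by $\int g\,e^{itx}=0$, so the measures agree.
  have hμ : (stdGaussian.withDensity fun x => ENNReal.ofReal (g x))
      = stdGaussian.withDensity fun x => ENNReal.ofReal (-g x) := by
    refine Measure.ext_of_charFun (funext fun t => ?_)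
    rw [hchar g hgm, hchar (fun x => -g x) hgm.neg, ← sub_eq_zero,
      ← integral_sub (hci _ hint.pos_part t) (hci _ hint.neg_part t),
      ← integral_mul_cexp_eq_zero hg h t]
    refine integral_congr_ae (ae_of_all _ fun x => ?_)
    dsimp only
    rw [← sub_mul, ← Complex.ofReal_sub, max_zero_sub_max_neg_zero_eq_self]
  have hae := (withDensity_eq_iff hgm.ennreal_ofReal.aemeasurable
    hgm.neg.ennreal_ofReal.aemeasurable (hfin g hint)).1 hμ
  filter_upwards [hae] with x hx
  rw [Pi.neg_apply] at hx
  rcases le_total 0 (g x) with h0 | h0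
  · rw [ENNReal.ofReal_of_nonpos (neg_nonpos.2 h0), ENNReal.ofReal_eq_zero] at hx
    exact le_antisymm hx h0
  · rw [ENNReal.ofReal_of_nonpos h0, eq_comm, ENNReal.ofReal_eq_zero] at hx
    exact le_antisymm h0 (by simpa using hx)

theorem inner_toLp {α : Type*} [MeasurableSpace α] {μ : Measure α} {f g : α → ℝ}
    (hf : MemLp f 2 μ) (hg : MemLp g 2 μ) :
    inner ℝ (hf.toLp f) (hg.toLp g) = ∫ x, f x * g x ∂μ := by
  rw [L2.inner_def]
  refine integral_congr_ae ?_
  filter_upwards [hf.coeFn_toLp, hg.coeFn_toLp] with x h1 h2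
  rw [h1, h2]
  simp [mul_comm]

theorem orthonormal_hermiteFn :
    Orthonormal ℝ fun k => (memLp_hermiteFn k).toLp (hermiteFn k) := by
  rw [orthonormal_iff_ite]
  intro j k
  rw [inner_toLp, integral_hermiteFn_mul]

/-- The Hermite polynomials as a Hilbert basis of `L²` of the standard Gaussian. -/
def hermiteBasis : HilbertBasis ℕ ℝ (Lp ℝ 2 stdGaussian) :=
  HilbertBasis.mkOfOrthogonalEqBot orthonormal_hermiteFn (by
    refine (Submodule.eq_bot_iff _).2 fun g hg => ?_
    refine (Lp.eq_zero_iff_ae_eq_zero).2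
      (ae_eq_zero_of_integral_hermiteFn (Lp.memLp g) fun k => ?_)
    have := (Submodule.mem_orthogonal _ _).1 hg _ (Submodule.subset_span ⟨k, rfl⟩)
    rw [real_inner_comm, ← Lp.toLp_coeFn g (Lp.memLp g), inner_toLp] at this
    exact this)

/-- Parseval's identity for the Hermite expansion. -/
theorem hasSum_sq_integral_hermiteFn {f : ℝ → ℝ} (hf : MemLp f 2 stdGaussian) :
    HasSum (fun k => (∫ x, hermiteFn k x * f x ∂stdGaussian) ^ 2)
      (∫ x, f x ^ 2 ∂stdGaussian) := by
  have h := hermiteBasis.hasSum_inner_mul_inner (hf.toLp f) (hf.toLp f)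
  have e : ∀ k, hermiteBasis k = (memLp_hermiteFn k).toLp (hermiteFn k) := fun k => by
    rw [hermiteBasis, HilbertBasis.coe_mkOfOrthogonalEqBot]
  simp_rw [e, inner_toLp] at h
  simp_rw [mul_comm (f _) (hermiteFn _ _), ← sq] at h
  exact h

end OneDimensionalHermite

/-! ### Products of Hermite polynomials and Cauchy–Schwarz on a set of coefficients. -/

section ProductHermite

open Filter

/-- If the expansion of `y` in an orthonormal family is complete along finite sets `K N` and is
supported on `T`, then the coefficients of `x` on `T` control `⟪x, y⟫`. -/
theorem inner_sq_le_of_tendsto {E κ : Type*} [NormedAddCommGroup E] [InnerProductSpace ℝ E]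
    {w : κ → E} (hw : Orthonormal ℝ w) {x y : E} {K : ℕ → Finset κ}
    (hK : Tendsto (fun N => ∑ k ∈ K N, inner ℝ (w k) y ^ 2) atTop (nhds (‖y‖ ^ 2)))
    {T : κ → Prop} (hT : ∀ k, inner ℝ (w k) y ≠ 0 → T k) {M : ℝ}
    (hM : ∀ s : Finset κ, (∀ k ∈ s, T k) → ∑ k ∈ s, inner ℝ (w k) x ^ 2 ≤ M) :
    inner ℝ x y ^ 2 ≤ ‖y‖ ^ 2 * M := by
  classical
  -- Convergence of the squared norms of the partial sums forces `z N` to tend to `y`, so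
  -- completeness is needed at `y` only, not for the whole family.
  set z : ℕ → E := fun N => ∑ k ∈ K N, inner ℝ (w k) y • w k with hz
  have hzy : ∀ N, ‖y - z N‖ ^ 2 = ‖y‖ ^ 2 - ∑ k ∈ K N, inner ℝ (w k) y ^ 2 := by
    intro N
    have h1 : inner ℝ y (z N) = ∑ k ∈ K N, inner ℝ (w k) y ^ 2 := by
      simp only [hz, inner_sum, real_inner_smul_right, real_inner_comm, sq]
    have h2 : ‖z N‖ ^ 2 = ∑ k ∈ K N, inner ℝ (w k) y ^ 2 := by
      rw [← real_inner_self_eq_norm_sq, hz, hw.inner_sum]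
      simp [sq]
    rw [norm_sub_sq_real, h1, h2]
    ring
  have hlim : Tendsto z atTop (nhds y) := by
    rw [tendsto_iff_norm_sub_tendsto_zero]
    have : Tendsto (fun N => √(‖y - z N‖ ^ 2)) atTop (nhds (√(‖y‖ ^ 2 - ‖y‖ ^ 2))) := by
      simp_rw [hzy]
      exact (Real.continuous_sqrt.tendsto _).comp (tendsto_const_nhds.sub hK)
    simpa [Real.sqrt_sq, norm_sub_rev] using this
  have hinner : Tendsto (fun N => inner ℝ x (z N) ^ 2) atTop (nhds (inner ℝ x y ^ 2)) :=
    ((tendsto_const_nhds (x := x)).inner hlim).pow 2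
  refine le_of_tendsto_of_tendsto' hinner (hK.mul_const M) fun N => ?_
  have e : inner ℝ x (z N)
      = ∑ k ∈ (K N).filter T, inner ℝ (w k) y * inner ℝ (w k) x := by
    simp only [hz, inner_sum, real_inner_smul_right]
    rw [Finset.sum_filter_of_ne fun k _ hk => hT k (left_ne_zero_of_mul hk)]
    simp only [real_inner_comm]
  rw [e]
  refine (Finset.sum_mul_sq_le_sq_mul_sq _ _ _).trans ?_
  have hM' := hM ((K N).filter T) fun k hk => (Finset.mem_filter.1 hk).2
  have h0 : 0 ≤ ∑ k ∈ (K N).filter T, inner ℝ (w k) x ^ 2 :=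
    Finset.sum_nonneg fun _ _ => sq_nonneg _
  exact mul_le_mul (Finset.sum_le_sum_of_subset_of_nonneg (Finset.filter_subset _ _)
    fun _ _ _ => sq_nonneg _) hM' h0 (Finset.sum_nonneg fun _ _ => sq_nonneg _)

variable {ι : Type*} [Fintype ι]

theorem memLp_prod_stdGaussian {f : ι → ℝ → ℝ} (h : ∀ i, MemLp (f i) 2 stdGaussian) :
    MemLp (fun x : ι → ℝ => ∏ i, f i (x i)) 2 (Measure.pi fun _ => stdGaussian) := by
  rw [memLp_two_iff_integrable_sq
    (Integrable.fintype_prod fun i => (h i).integrable one_le_two).1]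
  simp_rw [← Finset.prod_pow]
  exact Integrable.fintype_prod (f := fun i y => f i y ^ 2) fun i => (h i).integrable_sq

theorem inner_prod_stdGaussian {f g : ι → ℝ → ℝ} (hf : ∀ i, MemLp (f i) 2 stdGaussian)
    (hg : ∀ i, MemLp (g i) 2 stdGaussian) :
    inner ℝ ((memLp_prod_stdGaussian hf).toLp _) ((memLp_prod_stdGaussian hg).toLp _)
      = ∏ i, ∫ x, f i x * g i x ∂stdGaussian := by
  rw [inner_toLp]
  simp_rw [← Finset.prod_mul_distrib]
  exact integral_fintype_prod_eq_prod (fun i y => f i y * g i y)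

theorem orthonormal_prod_hermiteFn : Orthonormal ℝ fun k : ι → ℕ =>
    (memLp_prod_stdGaussian fun i => memLp_hermiteFn (k i)).toLp
      (fun x : ι → ℝ => ∏ i, hermiteFn (k i) (x i)) := by
  classical
  rw [orthonormal_iff_ite]
  intro j k
  rw [inner_prod_stdGaussian (fun i => memLp_hermiteFn (j i)) fun i => memLp_hermiteFn (k i)]
  simp_rw [integral_hermiteFn_mul]
  split_ifs with h
  · simp [h]
  · obtain ⟨i, hi⟩ := Function.ne_iff.1 h
    exact Finset.prod_eq_zero (Finset.mem_univ i) (if_neg hi)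

/-- Bessel's inequality in the form of summability. -/
theorem summable_sq_integral_prod_hermiteFn {F : (ι → ℝ) → ℝ}
    (hF : MemLp F 2 (Measure.pi fun _ => stdGaussian)) :
    Summable fun k : ι → ℕ =>
      (∫ x, F x * ∏ i, hermiteFn (k i) (x i) ∂(Measure.pi fun _ => stdGaussian)) ^ 2 := by
  have h := orthonormal_prod_hermiteFn.inner_products_summable (hF.toLp F)
  refine h.congr fun k => ?_
  rw [inner_toLp, Real.norm_eq_abs, sq_abs]
  simp_rw [mul_comm]

/-- Pairing with a product function whose Hermite expansion is supported on `T` is controlled by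
the coefficients on `T`. -/
theorem sq_integral_mul_prod_le {F : (ι → ℝ) → ℝ}
    (hF : MemLp F 2 (Measure.pi fun _ => stdGaussian)) {f : ι → ℝ → ℝ}
    (hf : ∀ i, MemLp (f i) 2 stdGaussian) {T : (ι → ℕ) → Prop}
    (hT : ∀ k : ι → ℕ, (∀ i, ∫ x, hermiteFn (k i) x * f i x ∂stdGaussian ≠ 0) → T k) {M : ℝ}
    (hM : ∀ s : Finset (ι → ℕ), (∀ k ∈ s, T k) → ∑ k ∈ s,
      (∫ x, F x * ∏ i, hermiteFn (k i) (x i) ∂(Measure.pi fun _ => stdGaussian)) ^ 2 ≤ M) :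
    (∫ x, F x * ∏ i, f i (x i) ∂(Measure.pi fun _ => stdGaussian)) ^ 2
      ≤ (∏ i, ∫ x, f i x ^ 2 ∂stdGaussian) * M := by
  classical
  have hy : ‖(memLp_prod_stdGaussian hf).toLp _‖ ^ 2 = ∏ i, ∫ x, f i x ^ 2 ∂stdGaussian := by
    rw [← real_inner_self_eq_norm_sq, inner_prod_stdGaussian hf hf]
    simp_rw [sq]
  rw [← inner_toLp hF (memLp_prod_stdGaussian hf), ← hy]
  refine inner_sq_le_of_tendsto (T := T) orthonormal_prod_hermiteFn
    (K := fun N => Fintype.piFinset fun _ => Finset.range N) ?_ (fun k hk => hT k fun i => ?_) ?_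
  · rw [hy]
    -- Over a cube of indices the sum of squares factors into one-dimensional partial sums, to which
    -- Parseval applies.
    have e : ∀ N, ∑ k ∈ Fintype.piFinset fun _ : ι => Finset.range N,
        inner ℝ ((memLp_prod_stdGaussian fun i => memLp_hermiteFn (k i)).toLp
          (fun x : ι → ℝ => ∏ i, hermiteFn (k i) (x i)))
          ((memLp_prod_stdGaussian hf).toLp _) ^ 2
        = ∏ i, ∑ k ∈ Finset.range N, (∫ x, hermiteFn k x * f i x ∂stdGaussian) ^ 2 := fun N => by
      rw [Finset.prod_univ_sum]
      refine Finset.sum_congr rfl fun k _ => ?_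
      rw [inner_prod_stdGaussian (fun i => memLp_hermiteFn (k i)) hf, Finset.prod_pow]
    simp_rw [e]
    exact tendsto_finsetProd _ fun i _ =>
      (hasSum_sq_integral_hermiteFn (hf i)).tendsto_sum_nat
  · rw [inner_prod_stdGaussian (fun i => memLp_hermiteFn (k i)) hf] at hk
    exact Finset.prod_ne_zero_iff.1 hk i (Finset.mem_univ i)
  · intro s hs
    refine le_of_eq_of_le (Finset.sum_congr rfl fun k _ => ?_) (hM s hs)
    rw [inner_toLp]
    simp_rw [mul_comm]

end ProductHermite

/-! ### Measurability of the ground state and lower bounds for spectral mass. -/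

section SpectralMass

theorem measurable_hamiltonian {V : Type*} (G : SimpleGraph V) [Fintype G.edgeSet]
    (σ : SpinConfig V) :
    Measurable fun J : Coupling G => hamiltonian G J σ := by
  unfold hamiltonian
  fun_prop

variable {V : Type*} (G : SimpleGraph V) [Finite V] [Fintype G.edgeSet]

/-- The chosen ground state depends measurably on the couplings: it is a function of the finite
set of all ground states. -/
theorem measurable_comp_groundState (F : SpinConfig V → ℝ) :
    Measurable fun J : Coupling G => F (groundState G J) := by
  classical
  cases nonempty_fintype V
  -- `Classical.choose` sees only the predicate, so equal sets of maximizers give the same chosen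
  -- ground state.
  have hdep : ∀ J J' : Coupling G, {σ | IsGroundState G J σ} = {σ | IsGroundState G J' σ} →
      groundState G J = groundState G J' := by
    intro J J' h
    have h' : IsGroundState G J = IsGroundState G J' := h
    unfold groundState
    congr 1
  have hset : ∀ A : Set (SpinConfig V),
      MeasurableSet {J : Coupling G | {σ | IsGroundState G J σ} = A} := by
    intro A
    have e : {J : Coupling G | {σ | IsGroundState G J σ} = A}
        = ⋂ σ, {J | IsGroundState G J σ ↔ σ ∈ A} := by
      ext J
      simp [Set.ext_iff]
    rw [e]
    refine MeasurableSet.iInter fun σ => ?_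
    have hσ : MeasurableSet {J : Coupling G | IsGroundState G J σ} := by
      have : {J : Coupling G | IsGroundState G J σ}
          = ⋂ τ, {J | hamiltonian G J τ ≤ hamiltonian G J σ} := by
        ext J
        simp [IsGroundState]
      rw [this]
      exact MeasurableSet.iInter fun τ =>
        measurableSet_le (measurable_hamiltonian G τ) (measurable_hamiltonian G σ)
    by_cases h : σ ∈ A
    · simpa [h] using hσ
    · have : {J : Coupling G | IsGroundState G J σ ↔ σ ∈ A}
          = {J : Coupling G | IsGroundState G J σ}ᶜ := by
        ext J
        simp [h]
      rw [this]
      exact hσ.compl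
  intro B _
  have e : (fun J : Coupling G => F (groundState G J)) ⁻¹' B
      = ⋃ A ∈ {A : Set (SpinConfig V) | ∃ J, {σ | IsGroundState G J σ} = A ∧
          F (groundState G J) ∈ B}, {J : Coupling G | {σ | IsGroundState G J σ} = A} := by
    ext J
    simp only [Set.mem_preimage, Set.mem_ofPred_eq, Set.mem_iUnion, exists_prop]
    constructor
    · exact fun h => ⟨_, ⟨J, rfl, h⟩, rfl⟩
    · rintro ⟨A, ⟨J', h1, h2⟩, h3⟩
      rwa [hdep J J' (h3.trans h1.symm)]
  rw [e]
  exact MeasurableSet.biUnion (Set.to_countable _) fun A _ => hset A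

theorem abs_relSpin (u v : V) (J : Coupling G) : |relSpin G u v J| = 1 := by
  unfold relSpin
  rcases Int.units_eq_one_or (groundState G J u * groundState G J v) with h | h <;> simp [h]

theorem memLp_relSpin (u v : V) :
    MemLp (relSpin G u v) 2 (Measure.pi fun _ : G.edgeSet => stdGaussian) := by
  refine MemLp.of_bound (C := 1)
    (measurable_comp_groundState G fun σ => (((σ u * σ v : ℤˣ) : ℤ) : ℝ)).aestronglyMeasurable
    (ae_of_all _ fun J => ?_)
  rw [Real.norm_eq_abs, abs_relSpin]

theorem summable_fourierCoeff_sq (u v : V) :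
    Summable fun k : G.edgeSet → ℕ => fourierCoeff G u v k ^ 2 :=
  summable_sq_integral_prod_hermiteFn (memLp_relSpin G u v)

/-- Grouping by support leaves finite partial sums of the series defining `spectralMass`. Bessel's
inequality supplies summability, without which that `tsum` would default to zero. -/
theorem sum_fourierCoeff_sq_le (u v : V) (𝒮 : Finset (Finset G.edgeSet))
    (s : Finset (G.edgeSet → ℕ)) (hs : ∀ k ∈ s, multiSupport G k ∈ 𝒮) :
    ∑ k ∈ s, fourierCoeff G u v k ^ 2 ≤ ∑ S ∈ 𝒮, spectralMass G u v S := by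
  classical
  rw [← Finset.sum_fiberwise_of_maps_to hs]
  refine Finset.sum_le_sum fun S _ => ?_
  have hsum : Summable fun k : {k : G.edgeSet → ℕ // multiSupport G k = S} =>
      fourierCoeff G u v k.1 ^ 2 :=
    (summable_fourierCoeff_sq G u v).comp_injective Subtype.val_injective
  have h := hsum.sum_le_tsum (s.subtype fun k => multiSupport G k = S) fun _ _ => sq_nonneg _
  refine le_of_eq_of_le ?_ h
  exact (Finset.sum_subtype_eq_sum_filter (s := s) (fun k => fourierCoeff G u v k ^ 2)
    (p := fun k => multiSupport G k = S)).symm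

/-- Lower bound for the spectral mass between `A` and `B` through a test function which is a
product of functions of the couplings in `B`, centred on `A`. -/
theorem sq_integral_relSpin_mul_prod_le (u v : V) {A B : Finset G.edgeSet}
    {𝒮 : Finset (Finset G.edgeSet)} (h𝒮 : ∀ S, A ⊆ S → S ⊆ B → S ∈ 𝒮)
    {f : G.edgeSet → ℝ → ℝ} (hf : ∀ e, MemLp (f e) 2 stdGaussian)
    (hA : ∀ e ∈ A, ∫ x, f e x ∂stdGaussian = 0) (hB : ∀ e ∉ B, f e = 1) :
    (∫ J, relSpin G u v J * ∏ e, f e (J e) ∂(couplingLaw G)) ^ 2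
      ≤ (∏ e, ∫ x, f e x ^ 2 ∂stdGaussian) * ∑ S ∈ 𝒮, spectralMass G u v S := by
  have h0 : ∀ x, hermiteFn 0 x = 1 := fun x => by simp [hermiteFn]
  refine sq_integral_mul_prod_le (memLp_relSpin G u v) hf
    (T := fun k => multiSupport G k ∈ 𝒮) (fun k hk => h𝒮 _ (fun e he => ?_) fun e he => ?_)
    (sum_fourierCoeff_sq_le G u v 𝒮)
  -- On `A` the coefficient of `f e` at degree zero is its mean, which vanishes.
  · simp only [multiSupport, Finset.mem_filter, Finset.mem_univ, true_and]
    by_contra hlt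
    refine hk e ?_
    rw [show k e = 0 by omega]
    simpa [h0] using hA e he
  -- Off `B` the factor is $1=h_0$, orthogonal to every Hermite polynomial of positive degree.
  · simp only [multiSupport, Finset.mem_filter, Finset.mem_univ, true_and] at he
    by_contra hne
    refine hk e ?_
    have := integral_hermiteFn_mul (k e) 0
    rw [if_neg (by omega)] at this
    simpa [h0, hB e hne] using this

end SpectralMass

/-! ### Flipping a set of spins. -/

section Flip

variable {V : Type*}

theorem abs_edgeSpin (σ : SpinConfig V) (e : Sym2 V) : |edgeSpin σ e| = 1 := by
  induction e with
  | _ x y =>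
    simp only [edgeSpin, Sym2.lift_mk]
    rcases Int.units_eq_one_or (σ x * σ y) with h | h <;> rw [h] <;> simp

/-- If `e₀` crosses the boundary of `A` and its coupling dominates the sum of all other couplings
across that boundary, then `e₀` is satisfied in every ground state. -/
theorem IsGroundState.satisfied_of_dominant {G : SimpleGraph V} [Fintype G.edgeSet]
    {J : Coupling G} {σ : SpinConfig V} (hσ : IsGroundState G J σ) (A : Set V) {e₀ : G.edgeSet}
    {x₀ y₀ : V} (he₀ : e₀.1 = s(x₀, y₀)) (hx₀ : x₀ ∈ A) (hy₀ : y₀ ∉ A) (P : Finset G.edgeSet)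
    (hP : ∀ e : G.edgeSet, e ∉ P → e ≠ e₀ → ∀ x y, e.1 = s(x, y) → x ∈ A → y ∈ A)
    (hlt : ∑ e ∈ P, |J e| < |J e₀|) : 0 < J e₀ * edgeSpin σ e₀ := by
  classical
  set τ : SpinConfig V := fun x => if x ∈ A then -σ x else σ x with hτ
  have hcross : ∀ x y, x ∈ A → y ∉ A → edgeSpin τ s(x, y) = -edgeSpin σ s(x, y) := by
    intro x y hx hy
    simp [edgeSpin, hτ, hx, hy]
  have hsame : ∀ x y, (x ∈ A ↔ y ∈ A) → edgeSpin τ s(x, y) = edgeSpin σ s(x, y) := by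
    intro x y hxy
    by_cases hx : x ∈ A
    · simp [edgeSpin, hτ, hx, hxy.1 hx]
    · simp [edgeSpin, hτ, hx, mt hxy.2 hx]
  have hsum : 0 ≤ ∑ e : G.edgeSet, J e * (edgeSpin σ e - edgeSpin τ e) := by
    have := hσ τ
    simp only [hamiltonian] at this
    simp only [mul_sub, Finset.sum_sub_distrib]
    linarith
  -- Only edges across the boundary of `A` change sign under the flip: `e₀` contributes its exact
  -- change, the others at most $2|J_e|$.
  have hterm : ∀ e : G.edgeSet, J e * (edgeSpin σ e - edgeSpin τ e)
      ≤ (if e = e₀ then 2 * (J e₀ * edgeSpin σ e₀) else 0) + if e ∈ P then 2 * |J e| else 0 := by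
    intro e
    have hPnn : (0 : ℝ) ≤ if e ∈ P then 2 * |J e| else 0 := by split_ifs <;> positivity
    by_cases h : e = e₀
    · subst h
      have : edgeSpin τ e = -edgeSpin σ e := by rw [he₀, hcross _ _ hx₀ hy₀]
      rw [this, if_pos rfl]
      linarith
    by_cases hmem : e ∈ P
    · rw [if_neg h, if_pos hmem, zero_add]
      refine (le_abs_self _).trans ?_
      rw [abs_mul, mul_comm]
      refine mul_le_mul_of_nonneg_right ((abs_sub _ _).trans ?_) (abs_nonneg _)
      rw [abs_edgeSpin, abs_edgeSpin]
      norm_num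
    · have hnc := hP e hmem h
      have : edgeSpin τ e = edgeSpin σ e := by
        obtain ⟨e, he⟩ := e
        induction e with
        | _ x y => exact hsame x y ⟨hnc x y rfl, hnc y x Sym2.eq_swap⟩
      simp [this, h, hmem]
  have htot := hsum.trans (Finset.sum_le_sum fun e _ => hterm e)
  rw [Finset.sum_add_distrib, Finset.sum_ite_eq', if_pos (Finset.mem_univ _),
    Finset.sum_ite_mem, Finset.univ_inter, ← Finset.mul_sum] at htot
  -- With $X=J_{e_0}\sigma_x\sigma_y$, `htot` and `hlt` give $X\ge-\sum_P|J_e|>-|X|$, which forces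
  -- $X>0$.
  have habs : |J e₀ * edgeSpin σ e₀| = |J e₀| := by rw [abs_mul, abs_edgeSpin, mul_one]
  rcases abs_cases (J e₀ * edgeSpin σ e₀) with h | h <;> linarith [abs_nonneg (J e₀)]

end Flip

/-! ### The middle row of the grid and its neighbouring edges. -/

section GridGeometry

variable {n : ℕ}

/-- The vertices of the middle row, counted from the left end. -/
def rowVertex (hn : 2 ≤ n) (k : ℕ) : GridVertex n :=
  -- The truncation at `n` keeps every natural index inside the grid, so telescoping needs no
  -- bounds.
  ⟨(min ((k : ℤ) + 1) n, (n : ℤ) / 2), by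
    simp only [Finset.mem_product, Finset.mem_Icc]; omega⟩

theorem rowVertex_zero (hn : 2 ≤ n) : rowVertex hn 0 = leftEnd n hn := by
  refine Subtype.ext (Prod.ext ?_ rfl)
  simp only [rowVertex, leftEnd]
  omega

theorem rowVertex_pred (hn : 2 ≤ n) : rowVertex hn (n - 1) = rightEnd n hn := by
  refine Subtype.ext (Prod.ext ?_ rfl)
  simp only [rowVertex, rightEnd]
  omega

/-- The edges of the horizontal line, counted from the left end. -/
def rowEdge (hn : 2 ≤ n) (k : Fin (n - 1)) : (grid n).edgeSet :=
  ⟨s(rowVertex hn k, rowVertex hn (k + 1)), by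
    have := k.2
    rw [SimpleGraph.mem_edgeSet]
    simp only [grid, rowVertex]
    rw [min_eq_left (by omega), min_eq_left (by push_cast; omega)]
    simp⟩

theorem map_val_rowEdge (hn : 2 ≤ n) (k : Fin (n - 1)) : Sym2.map Subtype.val (rowEdge hn k).1
    = s(((k : ℤ) + 1, (n : ℤ) / 2), ((k : ℤ) + 1 + 1, (n : ℤ) / 2)) := by
  have := k.2
  simp only [rowEdge, rowVertex, Sym2.map_mk]
  rw [min_eq_left (by omega), min_eq_left (by push_cast; omega)]
  push_cast
  rfl

theorem rowEdge_injective (hn : 2 ≤ n) : Function.Injective (rowEdge hn) := by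
  intro j k h
  have h' := map_val_rowEdge hn j
  rw [h, map_val_rowEdge] at h'
  simp only [Sym2.eq_iff, Prod.mk.injEq] at h'
  exact Fin.ext (by omega)

theorem mem_line_iff (hn : 2 ≤ n) (e : (grid n).edgeSet) : e ∈ line n ↔ ∃ k, rowEdge hn k = e := by
  simp only [line, Finset.mem_filter, Finset.mem_univ, true_and]
  constructor
  · rintro ⟨k, h1, h2, he⟩
    obtain ⟨j, hj⟩ := Int.eq_ofNat_of_zero_le (show 0 ≤ k - 1 by omega)
    obtain rfl : k = j + 1 := by omega
    refine ⟨⟨j, by omega⟩, Subtype.ext (Sym2.map.injective Subtype.val_injective ?_)⟩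
    rw [map_val_rowEdge, he]
  · rintro ⟨k, rfl⟩
    have := k.2
    exact ⟨(k : ℤ) + 1, by omega, by omega, map_val_rowEdge hn k⟩

theorem row_of_mem_line {e : (grid n).edgeSet} (he : e ∈ line n) {w : GridVertex n}
    (hw : w ∈ e.1) : w.1.2 = (n : ℤ) / 2 := by
  simp only [line, Finset.mem_filter, Finset.mem_univ, true_and] at he
  obtain ⟨k, _, _, he⟩ := he
  have : w.1 ∈ Sym2.map Subtype.val e.1 := Sym2.mem_map.2 ⟨w, hw, rfl⟩
  rw [he, Sym2.mem_iff] at this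
  rcases this with h | h <;> rw [h]

theorem exists_row_of_mem_lineHat {e : (grid n).edgeSet} (he : e ∈ lineHat n) :
    ∃ w : GridVertex n, w ∈ e.1 ∧ w.1.2 = (n : ℤ) / 2 := by
  simp only [lineHat, Finset.mem_union, Finset.mem_filter, Finset.mem_univ, true_and] at he
  rcases he with he | ⟨f, hf, w, hwe, hwf⟩
  · obtain ⟨⟨x, y⟩, h⟩ := e
    exact ⟨x, Sym2.mem_mk_left _ _, row_of_mem_line he (Sym2.mem_mk_left _ _)⟩
  · exact ⟨w, hwe, row_of_mem_line hf hwf⟩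

/-- Together with `exists_row_of_mem_lineHat`, this identifies $\widehat{\mathcal L}$ with the set
of edges meeting the middle row. -/
theorem mem_lineHat_of_row (hn : 2 ≤ n) {e : (grid n).edgeSet} {w : GridVertex n} (hw : w ∈ e.1)
    (hrow : w.1.2 = (n : ℤ) / 2) : e ∈ lineHat n := by
  simp only [lineHat, Finset.mem_union, Finset.mem_filter, Finset.mem_univ, true_and]
  right
  have hw' := w.2
  simp only [Finset.mem_product, Finset.mem_Icc] at hw'
  obtain ⟨j, hj⟩ := Int.eq_ofNat_of_zero_le (show 0 ≤ w.1.1 - 1 by omega)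
  have hwj : w = rowVertex hn j := by
    refine Subtype.ext (Prod.ext ?_ hrow)
    simp only [rowVertex]
    omega
  by_cases hlast : j < n - 1
  · refine ⟨rowEdge hn ⟨j, hlast⟩, (mem_line_iff hn _).2 ⟨_, rfl⟩, w, hw, ?_⟩
    rw [hwj]
    exact Sym2.mem_mk_left _ _
  -- The last vertex of the row starts no line edge; it is the right end of the preceding one, which
  -- exists as $n\ge2$.
  · refine ⟨rowEdge hn ⟨j - 1, by omega⟩, (mem_line_iff hn _).2 ⟨_, rfl⟩, w, hw, ?_⟩
    have hwj' : w = rowVertex hn (j - 1 + 1) := by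
      rw [hwj, show j - 1 + 1 = j by omega]
    exact Sym2.mem_iff.2 (Or.inr hwj')

theorem line_subset_lineHat : line n ⊆ lineHat n := Finset.subset_union_left

/-- Each such edge leaves one of the $n$ row vertices in one of four directions. This count fixes
both the cut-off $1/(4n)$ and the exponent $4n$. -/
theorem card_lineHat_le : (lineHat n).card ≤ 4 * n := by
  classical
  set D : Finset (ℤ × ℤ) := {(1, 0), (-1, 0), (0, 1), (0, -1)} with hD
  set R : Finset (Sym2 (ℤ × ℤ)) := (Finset.Icc (1 : ℤ) n ×ˢ D).image
    fun q => s((q.1, (n : ℤ) / 2), (q.1 + q.2.1, (n : ℤ) / 2 + q.2.2)) with hR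
  have hRcard : R.card ≤ 4 * n := by
    refine Finset.card_image_le.trans ?_
    rw [Finset.card_product]
    have : D.card = 4 := by rw [hD]; rfl
    rw [this, Int.card_Icc]
    omega
  refine le_trans (Finset.card_le_card_of_injOn (fun e => Sym2.map Subtype.val e.1) ?_ ?_) hRcard
  · intro e he
    obtain ⟨w, hw, hrow⟩ := exists_row_of_mem_lineHat he
    obtain ⟨e, hadj⟩ := e
    obtain ⟨y, rfl⟩ := hw
    rw [SimpleGraph.mem_edgeSet] at hadj
    have hw' := w.2
    simp only [Finset.mem_product, Finset.mem_Icc] at hw'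
    simp only [grid] at hadj
    refine Finset.mem_coe.2 (Finset.mem_image.2
      ⟨(w.1.1, (y.1.1 - w.1.1, y.1.2 - w.1.2)), ?_, ?_⟩)
    · refine Finset.mem_product.2 ⟨Finset.mem_Icc.2 hw'.1, ?_⟩
      simp only [hD, Finset.mem_insert, Finset.mem_singleton, Prod.mk.injEq]
      rcases abs_cases (w.1.1 - y.1.1) with h | h <;>
        rcases abs_cases (w.1.2 - y.1.2) with h' | h' <;> omega
    · simp only [Sym2.map_mk, ← hrow, add_sub_cancel]
  · intro e _ f _ h
    exact Subtype.ext (Sym2.map.injective Subtype.val_injective h)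

/-- The product telescopes: each interior spin of the row occurs twice. -/
theorem edgeSpin_prod_line (hn : 2 ≤ n) (σ : SpinConfig (GridVertex n)) :
    ∏ e ∈ line n, edgeSpin σ e = ((σ (leftEnd n hn) * σ (rightEnd n hn) : ℤˣ) : ℤ) := by
  classical
  have hline : line n = Finset.univ.image (rowEdge hn) := by
    ext e
    simp [mem_line_iff hn]
  rw [hline, Finset.prod_image (rowEdge_injective hn).injOn]
  have htel : ∀ m : ℕ, ∏ k ∈ Finset.range m, (σ (rowVertex hn k) * σ (rowVertex hn (k + 1)))
      = σ (rowVertex hn 0) * σ (rowVertex hn m) := by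
    intro m
    induction m with
    | zero => simp
    | succ m ih =>
      rw [Finset.prod_range_succ, ih, mul_assoc, ← mul_assoc (σ (rowVertex hn m)),
        Int.units_mul_self, one_mul]
  rw [← rowVertex_zero, ← rowVertex_pred, ← htel, ← Fin.prod_univ_eq_prod_range
    (fun k => σ (rowVertex hn k) * σ (rowVertex hn (k + 1)))]
  push_cast
  refine Finset.prod_congr rfl fun k _ => ?_
  simp [rowEdge, edgeSpin]

/-- When the couplings on the line dominate those next to it, every ground state satisfies all
edges of the line. -/
theorem IsGroundState.satisfied_of_mem_line (hn : 2 ≤ n) {J : Coupling (grid n)}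
    {σ : SpinConfig (GridVertex n)} (hσ : IsGroundState (grid n) J σ)
    (hline : ∀ e ∈ line n, 1 < |J e|)
    (hhat : ∀ e ∈ lineHat n, e ∉ line n → |J e| ≤ 1 / (4 * n))
    {e : (grid n).edgeSet} (he : e ∈ line n) : 0 < J e * edgeSpin σ e := by
  classical
  obtain ⟨k, rfl⟩ := (mem_line_iff hn e).1 he
  have hk := k.2
  -- The flipped set is the part of the row up to the left end of the edge. No other line edge
  -- leaves it, so the rest of its boundary lies in $\widehat{\mathcal L}\setminus\mathcal L$.
  refine hσ.satisfied_of_dominant {x | x.1.2 = (n : ℤ) / 2 ∧ x.1.1 ≤ (k : ℤ) + 1} rfl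
    ?_ ?_ (lineHat n \ line n) ?_ ?_
  · exact ⟨rfl, min_le_left _ _⟩
  · rintro ⟨-, h⟩
    simp only [rowVertex] at h
    omega
  · rintro e hne hek x y hxy ⟨hxrow, hxk⟩
    have hx : x ∈ e.1 := hxy ▸ Sym2.mem_mk_left x y
    have hy : y ∈ e.1 := hxy ▸ Sym2.mem_mk_right x y
    have hel : e ∈ line n := by
      by_contra h
      exact hne (Finset.mem_sdiff.2 ⟨mem_lineHat_of_row hn hx hxrow, h⟩)
    refine ⟨row_of_mem_line hel hy, ?_⟩
    obtain ⟨j, rfl⟩ := (mem_line_iff hn e).1 hel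
    have hjk : (j : ℕ) ≠ k := fun h => hek (by rw [Fin.ext h])
    have h := map_val_rowEdge hn j
    rw [hxy, Sym2.map_mk, Sym2.eq_iff] at h
    rcases h with ⟨h1, h2⟩ | ⟨h1, h2⟩
    · rw [h1] at hxk
      rw [h2]
      simp only at hxk ⊢
      omega
    · rw [h1] at hxk
      rw [h2]
      simp only at hxk ⊢
      omega
  · refine lt_of_le_of_lt ?_ (hline _ he)
    have hn0 : (0 : ℝ) < n := by positivity
    calc ∑ e ∈ lineHat n \ line n, |J e|
        ≤ (lineHat n \ line n).card • (1 / (4 * (n : ℝ))) :=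
          Finset.sum_le_card_nsmul _ _ _ fun e h =>
            hhat e (Finset.mem_sdiff.1 h).1 (Finset.mem_sdiff.1 h).2
      _ ≤ (4 * n : ℕ) • (1 / (4 * (n : ℝ))) :=
          nsmul_le_nsmul_left (by positivity)
            ((Finset.card_le_card Finset.sdiff_subset).trans card_lineHat_le)
      _ = 1 := by
          rw [nsmul_eq_mul]
          push_cast
          field_simp

end GridGeometry

/-! ### The test function and its second moment. -/

section TestFunctions

open Set

/-- The sign of `x`, cut off to zero for `|x| ≤ 1`. -/
def largeSign (x : ℝ) : ℝ := if 1 < |x| then Real.sign x else 0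

theorem measurable_largeSign : Measurable largeSign := by
  have hs : Measurable Real.sign := by
    have : Real.sign = fun r : ℝ => if r < 0 then (-1 : ℝ) else if 0 < r then 1 else 0 := rfl
    rw [this]
    exact Measurable.ite measurableSet_Iio measurable_const
      (Measurable.ite measurableSet_Ioi measurable_const measurable_const)
  exact Measurable.ite (measurableSet_lt measurable_const measurable_id.abs) hs measurable_const

theorem largeSign_sq (x : ℝ) : largeSign x ^ 2 = indicator {y : ℝ | 1 < |y|} 1 x := by
  by_cases h : 1 < |x|
  · have hx : x ≠ 0 := by
      rintro rfl
      norm_num at h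
    rcases Real.sign_apply_eq_of_ne_zero x hx with hs | hs <;> simp [largeSign, h, hs]
  · simp [largeSign, h]

theorem abs_largeSign_le_one (x : ℝ) : |largeSign x| ≤ 1 := by
  rw [← sq_le_one_iff_abs_le_one, largeSign_sq]
  exact indicator_le_self' (f := 1) (fun _ _ => zero_le_one) x

theorem memLp_largeSign : MemLp largeSign 2 stdGaussian :=
  MemLp.of_bound measurable_largeSign.aestronglyMeasurable 1
    (ae_of_all _ fun x => by rw [Real.norm_eq_abs]; exact abs_largeSign_le_one x)

/-- Odd function, symmetric measure. This centring is what forces $k_e\ge1$ on the line. -/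
theorem integral_largeSign : ∫ x, largeSign x ∂stdGaussian = 0 := by
  have hodd : ∀ x, largeSign (-x) = -largeSign x := fun x => by
    simp only [largeSign, abs_neg, Real.sign_neg]
    split_ifs <;> simp
  have hmap : stdGaussian.map (fun x => -x) = stdGaussian := by
    rw [gaussianReal_map_neg, neg_zero]
  have h := integral_map (μ := stdGaussian) measurable_neg.aemeasurable
    measurable_largeSign.aestronglyMeasurable
  rw [hmap] at h
  simp_rw [hodd, integral_neg] at h
  linarith

theorem integral_largeSign_sq_pos : 0 < ∫ x, largeSign x ^ 2 ∂stdGaussian := by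
  have hopen : IsOpen {y : ℝ | 1 < |y|} := isOpen_lt continuous_const continuous_abs
  simp_rw [largeSign_sq]
  rw [integral_indicator_one hopen.measurableSet, measureReal_def]
  refine ENNReal.toReal_pos (fun h => ?_) (measure_ne_top _ _)
  exact (hopen.measure_pos volume ⟨2, by norm_num⟩).ne'
    (gaussianReal_absolutelyContinuous' 0 one_ne_zero h)

/-- On $[-\varepsilon,\varepsilon]\subseteq[-1,1]$ the Gaussian density is at least its value at
$1$. -/
theorem le_integral_indicator_Icc {ε : ℝ} (h0 : 0 ≤ ε) (h1 : ε ≤ 1) :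
    2 * ε * gaussianPDFReal 0 1 1
      ≤ ∫ x, (indicator (Icc (-ε) ε) 1 x : ℝ) ^ 2 ∂stdGaussian := by
  have hsq : ∀ x, (indicator (Icc (-ε) ε) 1 x : ℝ) ^ 2 = indicator (Icc (-ε) ε) 1 x := fun x => by
    by_cases h : x ∈ Icc (-ε) ε <;> simp [h]
  simp_rw [hsq]
  rw [integral_indicator_one measurableSet_Icc, measureReal_def,
    gaussianReal_apply_eq_integral 0 one_ne_zero, ENNReal.toReal_ofReal
      (setIntegral_nonneg measurableSet_Icc fun x _ => gaussianPDFReal_nonneg _ _ _)]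
  have h := setIntegral_ge_of_const_le_real (μ := volume) (c := gaussianPDFReal 0 1 1)
    (f := gaussianPDFReal 0 1) (s := Icc (-ε) ε) measurableSet_Icc (by simp) (fun x hx => by
      simp only [gaussianPDFReal]
      refine mul_le_mul_of_nonneg_left (Real.exp_le_exp.2 ?_) (by positivity)
      have : x ^ 2 ≤ 1 := by
        rw [sq_le_one_iff_abs_le_one]
        exact (abs_le.2 hx).trans h1
      norm_num
      linarith) (integrable_gaussianPDFReal 0 1).integrableOn
  rw [measureReal_def, Real.volume_Icc, ENNReal.toReal_ofReal (by linarith)] at h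
  linarith

variable (n : ℕ)

open Classical in
/-- The factor at the edge `e` of the test function: on the line the cut-off sign of the coupling,
next to it the indicator that the coupling is small. -/
def testFn (e : (grid n).edgeSet) : ℝ → ℝ :=
  if e ∈ line n then largeSign
  else if e ∈ lineHat n then indicator (Icc (-(1 / (4 * (n : ℝ)))) (1 / (4 * n))) 1
  else 1

theorem memLp_testFn (e : (grid n).edgeSet) : MemLp (testFn n e) 2 stdGaussian := by
  unfold testFn
  split_ifs
  · exact memLp_largeSign
  · exact (memLp_const (1 : ℝ)).indicator measurableSet_Icc
  · exact memLp_const (1 : ℝ)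

variable {n}

/-- If some factor vanishes, both sides are zero. Otherwise domination makes each edge spin on the
line equal to the sign of its coupling, and the relative spin is the product of these edge spins. -/
theorem relSpin_mul_prod_testFn (hn : 2 ≤ n) (J : Coupling (grid n)) :
    relSpin (grid n) (leftEnd n hn) (rightEnd n hn) J * ∏ e, testFn n e (J e)
      = ∏ e, testFn n e (J e) ^ 2 := by
  classical
  by_cases h0 : ∃ e, testFn n e (J e) = 0
  · obtain ⟨e, he⟩ := h0
    rw [Finset.prod_eq_zero (Finset.mem_univ e) he,
      Finset.prod_eq_zero (Finset.mem_univ e) (by rw [he]; simp), mul_zero]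
  push Not at h0
  have hline : ∀ e ∈ line n, 1 < |J e| := fun e he => by
    by_contra h
    exact h0 e (by simp [testFn, he, largeSign, h])
  have hhat : ∀ e ∈ lineHat n, e ∉ line n → |J e| ≤ 1 / (4 * n) := fun e he hne => by
    by_contra h
    rw [abs_le] at h
    exact h0 e (by rw [testFn, if_neg hne, if_pos he, indicator_of_notMem (show J e ∉ Icc _ _ from h)])
  have hσ : IsGroundState (grid n) J (groundState (grid n) J) :=
    Classical.choose_spec (exists_isGroundState (grid n) J)
  rw [relSpin, ← edgeSpin_prod_line, ← Finset.univ_inter (line n), ← Finset.prod_ite_mem,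
    ← Finset.prod_mul_distrib]
  refine Finset.prod_congr rfl fun e _ => ?_
  by_cases he : e ∈ line n
  · have hpos := hσ.satisfied_of_mem_line hn hline hhat he
    have hJ := hline e he
    simp only [testFn, he, if_true, largeSign, hJ]
    have habs := abs_edgeSpin (groundState (grid n) J) e.1
    rcases eq_or_eq_neg_of_abs_eq habs with hs | hs
    · rw [hs, mul_one] at hpos
      rw [hs, Real.sign_of_pos hpos]
      norm_num
    · rw [hs] at hpos
      rw [hs, Real.sign_of_neg (by linarith)]
      norm_num
  · rw [if_neg he, one_mul]
    by_cases hh : e ∈ lineHat n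
    · have := abs_le.1 (hhat e hh he)
      rw [testFn, if_neg he, if_pos hh, indicator_of_mem (show J e ∈ Icc _ _ from this)]
      simp
    · simp [testFn, he, hh]

/-- With $m=\mathbb E f^2$ the Cauchy–Schwarz bound reads $m^2\le m\sum\mu(S)$; positivity of $m$
allows one factor to be cancelled. -/
theorem prod_integral_testFn_sq_le (hn : 2 ≤ n) {𝒮 : Finset (Finset (grid n).edgeSet)}
    (h𝒮 : ∀ S, line n ⊆ S → S ⊆ lineHat n → S ∈ 𝒮)
    (hpos : 0 < ∏ e, ∫ x, testFn n e x ^ 2 ∂stdGaussian) :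
    ∏ e, ∫ x, testFn n e x ^ 2 ∂stdGaussian
      ≤ ∑ S ∈ 𝒮, spectralMass (grid n) (leftEnd n hn) (rightEnd n hn) S := by
  have h := sq_integral_relSpin_mul_prod_le (grid n) (leftEnd n hn) (rightEnd n hn) h𝒮
    (memLp_testFn n) (fun e he => by rw [testFn, if_pos he]; exact integral_largeSign)
    (fun e he => by
      rw [testFn, if_neg fun hl => he (line_subset_lineHat hl), if_neg he])
  simp_rw [relSpin_mul_prod_testFn hn] at h
  rw [couplingLaw, integral_fintype_prod_eq_prod (fun e x => testFn n e x ^ 2), sq] at h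
  exact le_of_mul_le_mul_left h hpos

/-- A lower bound for the second moment of the test function. -/
theorem exists_pow_le_prod_integral_testFn_sq : ∃ δ : ℝ, 0 < δ ∧ δ ≤ 1 ∧ ∀ n : ℕ, 2 ≤ n →
    (δ / n) ^ (4 * n) ≤ ∏ e, ∫ x, testFn n e x ^ 2 ∂stdGaussian := by
  classical
  have hpdf : 0 < gaussianPDFReal 0 1 1 := gaussianPDFReal_pos _ _ _ one_ne_zero
  -- The three entries serve, in order, monotonicity in the exponent, the line factors, and the
  -- small-coupling factors, whose mass is at least $2\cdot\frac1{4n}$ times the density at $1$.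
  set δ := min 1 (min (∫ x, largeSign x ^ 2 ∂stdGaussian) (gaussianPDFReal 0 1 1 / 2)) with hδ
  have hδ0 : 0 < δ := lt_min one_pos (lt_min integral_largeSign_sq_pos (half_pos hpdf))
  have hδ1 : δ ≤ 1 := min_le_left _ _
  refine ⟨δ, hδ0, hδ1, fun n hn => ?_⟩
  have hn1 : (1 : ℝ) ≤ n := by exact_mod_cast (by omega : 1 ≤ n)
  have hn0 : (0 : ℝ) < n := by linarith
  have hle : δ / n ≤ δ := div_le_self hδ0.le hn1
  have hnn : 0 ≤ δ / n := (div_pos hδ0 hn0).le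
  calc (δ / n) ^ (4 * n) ≤ (δ / n) ^ (lineHat n).card :=
        pow_le_pow_of_le_one hnn (hle.trans hδ1) card_lineHat_le
    _ = ∏ e, if e ∈ lineHat n then δ / n else 1 := by
        rw [Finset.prod_ite_mem, Finset.univ_inter, Finset.prod_const]
    _ ≤ ∏ e, ∫ x, testFn n e x ^ 2 ∂stdGaussian := by
        refine Finset.prod_le_prod (fun e _ => by split_ifs <;> positivity) fun e _ => ?_
        by_cases hl : e ∈ line n
        · rw [if_pos (line_subset_lineHat hl), testFn, if_pos hl]
          exact hle.trans ((min_le_right _ _).trans (min_le_left _ _))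
        by_cases hh : e ∈ lineHat n
        · rw [if_pos hh, testFn, if_neg hl, if_pos hh]
          refine le_trans ?_ (le_integral_indicator_Icc (by positivity) ?_)
          · have : δ ≤ gaussianPDFReal 0 1 1 / 2 := (min_le_right _ _).trans (min_le_right _ _)
            calc δ / n ≤ gaussianPDFReal 0 1 1 / 2 / n := by gcongr
              _ = 2 * (1 / (4 * n)) * gaussianPDFReal 0 1 1 := by field_simp; norm_num
          · rw [div_le_one (by positivity)]
            linarith
        · rw [if_neg hh, testFn, if_neg hl, if_neg hh]
          simp

end TestFunctions

/-- The elementary comparison of `(δ / n) ^ (4 n)` with `exp (-c n log n)`. -/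
theorem exists_exp_mul_two_pow_le {δ : ℝ} (hδ0 : 0 < δ) (hδ1 : δ ≤ 1) :
    ∃ c : ℝ, 0 < c ∧ ∀ n : ℕ, 2 ≤ n →
      2 ^ (4 * n) * Real.exp (-c * n * Real.log n) ≤ (δ / n) ^ (4 * n) := by
  have hlog2 : 0 < Real.log 2 := Real.log_pos one_lt_two
  have hlogδ : Real.log δ ≤ 0 := Real.log_nonpos hδ0.le hδ1
  -- Of the $8$, one $4$ pays for $n^{-4n}$ and one for $2^{4n}$, using $\log2\le\log n$; the last
  -- term pays for $\delta^{4n}$ in the same way.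
  refine ⟨8 + 4 * (-Real.log δ / Real.log 2), ?_, fun n hn => ?_⟩
  · have : 0 ≤ -Real.log δ / Real.log 2 := div_nonneg (by linarith) hlog2.le
    linarith
  have hn2 : (2 : ℝ) ≤ n := by exact_mod_cast hn
  have hn0 : (0 : ℝ) < n := by linarith
  have hlog : Real.log 2 ≤ Real.log n := Real.log_le_log two_pos hn2
  have hD : -Real.log δ ≤ -Real.log δ / Real.log 2 * Real.log n := by
    rw [div_mul_eq_mul_div, le_div_iff₀ hlog2]
    exact mul_le_mul_of_nonneg_left hlog (by linarith)
  rw [← Real.log_le_log_iff (by positivity) (by positivity),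
    Real.log_mul (by positivity) (by positivity), Real.log_exp, Real.log_pow, Real.log_pow,
    Real.log_div hδ0.ne' hn0.ne']
  push_cast
  have h1 := mul_le_mul_of_nonneg_left hD hn0.le
  have h2 := mul_le_mul_of_nonneg_left hlog hn0.le
  linarith

end EdwardsAnderson

end

/-! ### Conclusion: the total mass and pigeonhole over the admissible sets. -/

open Classical in
theorem mainTheorem3 :
    ∃ c : ℝ, 0 < c ∧ ∀ (n : ℕ) (hn : 2 ≤ n), Even n →
      Real.exp (-c * n * Real.log n) ≤
          (∑ S : Finset (EdwardsAnderson.grid n).edgeSet with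
            EdwardsAnderson.line n ⊆ S ∧ S ⊆ EdwardsAnderson.lineHat n,
            EdwardsAnderson.spectralMass (EdwardsAnderson.grid n)
              (EdwardsAnderson.leftEnd n hn) (EdwardsAnderson.rightEnd n hn) S) ∧
        ∃ S : Finset (EdwardsAnderson.grid n).edgeSet,
          EdwardsAnderson.line n ⊆ S ∧ S ⊆ EdwardsAnderson.lineHat n ∧
          Real.exp (-c * n * Real.log n) ≤
            EdwardsAnderson.spectralMass (EdwardsAnderson.grid n)
              (EdwardsAnderson.leftEnd n hn) (EdwardsAnderson.rightEnd n hn) S := by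
  obtain ⟨δ, hδ0, hδ1, hδ⟩ := EdwardsAnderson.exists_pow_le_prod_integral_testFn_sq
  obtain ⟨c, hc0, hc⟩ := EdwardsAnderson.exists_exp_mul_two_pow_le hδ0 hδ1
  refine ⟨c, hc0, fun n hn _ => ?_⟩
  have hn0 : (0 : ℝ) < n := by exact_mod_cast (by omega : 0 < n)
  set 𝒮 : Finset (Finset (EdwardsAnderson.grid n).edgeSet) := Finset.univ.filter fun S =>
    EdwardsAnderson.line n ⊆ S ∧ S ⊆ EdwardsAnderson.lineHat n with h𝒮
  have hsum := (hc n hn).trans ((hδ n hn).trans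
    (EdwardsAnderson.prod_integral_testFn_sq_le hn (𝒮 := 𝒮)
      (fun S h1 h2 => by simp [h𝒮, h1, h2]) (lt_of_lt_of_le (by positivity) (hδ n hn))))
  refine ⟨le_trans (le_mul_of_one_le_left (Real.exp_pos _).le
    (one_le_pow₀ one_le_two)) hsum, ?_⟩
  have hne : 𝒮.Nonempty :=
    ⟨EdwardsAnderson.line n, by simp [h𝒮, EdwardsAnderson.line_subset_lineHat]⟩
  have hcard : (𝒮.card : ℝ) ≤ 2 ^ (4 * n) := by
    have h1 : 𝒮.card ≤ 2 ^ (EdwardsAnderson.lineHat n).card := by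
      rw [← Finset.card_powerset]
      refine Finset.card_le_card fun S hS => ?_
      exact Finset.mem_powerset.2 (Finset.mem_filter.1 hS).2.2
    exact_mod_cast h1.trans (Nat.pow_le_pow_right two_pos EdwardsAnderson.card_lineHat_le)
  -- Pigeonhole: the total mass is at least $2^{4n}e^{-cn\log n}$ and there are at most $2^{4n}$
  -- sets.
  obtain ⟨S, hS, hle⟩ := Finset.exists_le_of_sum_le hne
    (f := fun _ => Real.exp (-c * n * Real.log n)) (g := fun S =>
      EdwardsAnderson.spectralMass (EdwardsAnderson.grid n)
        (EdwardsAnderson.leftEnd n hn) (EdwardsAnderson.rightEnd n hn) S) (by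
      rw [Finset.sum_const, nsmul_eq_mul]
      exact (mul_le_mul_of_nonneg_right hcard (Real.exp_pos _).le).trans hsum)
  exact ⟨S, (Finset.mem_filter.1 hS).2.1, (Finset.mem_filter.1 hS).2.2, hle⟩
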